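/- Let $\mathcal V$ be a countably infinite set of variables, let $\mathcal C$ be a set of constants, and let $\rho:\mathcal V\to\mathcal C$ be a bijection. Let $\Lambda$ be the set of finite raw $\lambda$-terms $M::=x\mid \lambda x.M\mid MM$ over $\mathcal V$, and $\Lambda(\mathcal C)$ the set of finite raw $\lambda$-terms that may also contain constants from $\mathcal C$. Let $\Lambda(\mathcal C)^\infty$ be the set of finite and infinite raw terms given by the same grammar read coinductively. The truncation $M^n$ of a finite or infinite term is given by $M^0=*$ (a new constant), $x^{n+1}=x$, $c^{n+1}=c$, $(\lambda x.N)^{n+1}=\lambda x.N^n$, $(NP)^{n+1}=N^nP^n$. On finite terms $=_\alpha$ is the usual $\alpha$-equivalence. For infinite terms, $M=_\alpha N$ means that $M^n=_\alpha N^n$ for all $n$, and $\mathsf{fv}(M)=\bigcup_n\mathsf{fv}(M^n)$. Sets of $\alpha$-classes carry the metric $d_\alpha([M],[N])=\inf\{2^{-n}\mid M^n=_\alpha N^n\}$. Let $(\Lambda/{=_\alpha})^\infty$ be the metric completion of $(\Lambda/{=_\alpha},d_\alpha)$. Let $\Lambda(\mathcal C)^\infty_{\mathrm{ffv}}$ be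 the set of those $M\in\Lambda(\mathcal C)^\infty$ for which $\mathsf{fv}(M)$ is finite, and let $(\Lambda(\mathcal C)^\infty_{\mathrm{ffv}}/{=_\alpha})^0$ be the set of closed $\alpha$-classes (those with $\mathsf{fv}=\emptyset$) of such terms. Let $\mathsf{Tr}:\Lambda\to\Lambda(\mathcal C)$ be defined by $\mathsf{Tr}(x)=\rho(x)$, $\mathsf{Tr}(MN)=\mathsf{Tr}(M)\mathsf{Tr}(N)$, and $\mathsf{Tr}(\lambda x.M)=\lambda x.M'$, where $M'$ is $\mathsf{Tr}(M)$ with the constant $\rho(x)$ replaced by $x$. Then $(\Lambda/{=_\alpha})^\infty$ is isomorphic to $(\Lambda(\mathcal C)^\infty_{\mathrm{ffv}}/{=_\alpha})^0$ via $\mathsf{Tr}$: there is a unique isometric bijection $$\Phi:(\Lambda/{=_\alpha})^\infty\longrightarrow(\Lambda(\mathcal C)^\infty_{\mathrm{ffv}}/{=_\alpha})^0$$ with $\Phi([M]_\alpha)=[\mathsf{Tr}(M)]_\alpha$ for every $M\in\Lambda$. -/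

import Mathlib

noncomputable section

namespace InfLam

universe u v w

/-! ### Finite λ-terms -/

/-- Finite raw λ-terms with variables in `V` and constants in `K`:
`M ::= x | c | λ x. M | M M`. The constant-free terms are `Term V Empty`. -/
inductive Term (V : Type u) (K : Type v) : Type (max u v)
  | var (x : V) : Term V K
  | const (c : K) : Term V K
  | lam (x : V) (M : Term V K) : Term V K
  | app (M N : Term V K) : Term V K

namespace Term

variable {V : Type u} {K : Type v}

/-- The action of a permutation of the variables (on free, bound and binding occurrences alike);
constants are fixed. -/
def perm (π : Equiv.Perm V) : Term V K → Term V K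
  | var x => var (π x)
  | const c => const c
  | lam x M => lam (π x) (perm π M)
  | app M N => app (perm π M) (perm π N)

/-- All variables of a raw term, free, bound or binding. -/
def vars : Term V K → Set V
  | var x => {x}
  | const _ => ∅
  | lam x M => insert x (vars M)
  | app M N => vars M ∪ vars N

/-- Free variables. -/
def fv : Term V K → Set V
  | var x => {x}
  | const _ => ∅
  | lam x M => fv M \ {x}
  | app M N => fv M ∪ fv N

/-- α-equivalence: the least equivalence relation that is closed under application and under the
rule deriving `λ x. M =α λ y. N` from `(x z) · M =α (y z) · N` for a variable `z` that is fresh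
for `x`, `y`, `M`, `N`. (The axioms for variables and constants are instances of `refl`.) -/
inductive AlphaEq [DecidableEq V] : Term V K → Term V K → Prop
  | refl (M : Term V K) : AlphaEq M M
  | symm {M N : Term V K} : AlphaEq M N → AlphaEq N M
  | trans {M N P : Term V K} : AlphaEq M N → AlphaEq N P → AlphaEq M P
  | app {M N M' N' : Term V K} : AlphaEq M N → AlphaEq M' N' → AlphaEq (app M M') (app N N')
  | abs {x y z : V} {M N : Term V K} (hx : z ≠ x) (hy : z ≠ y) (hM : z ∉ vars M)
      (hN : z ∉ vars N) :
      AlphaEq (perm (Equiv.swap x z) M) (perm (Equiv.swap y z) N) → AlphaEq (lam x M) (lam y N)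

/-- The truncation `M ^ n` at depth `n`. It is a term over the constants `K` extended with one
new constant `*`, which is `none : Option K`. -/
def trunc : ℕ → Term V K → Term V (Option K)
  | 0, _ => const none
  | _ + 1, var x => var x
  | _ + 1, const c => const (some c)
  | n + 1, lam x M => lam x (trunc n M)
  | n + 1, app M N => app (trunc n M) (trunc n N)

/-- `replaceConst c x M` replaces every occurrence of the constant `c` in `M` by the
variable `x`. -/
def replaceConst [DecidableEq K] (c : K) (x : V) : Term V K → Term V K
  | var y => var y
  | const d => if d = c then var x else const d
  | lam y M => lam y (replaceConst c x M)
  | app M N => app (replaceConst c x M) (replaceConst c x N)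

/-- The translation `Tr` that turns the free variables `x` of a constant-free term into the
constants `ρ x`:
`Tr x = ρ x`, `Tr (M N) = Tr M (Tr N)`, `Tr (λ x. M) = λ x. (Tr M with ρ x replaced by x)`. -/
def tr {C : Type w} [DecidableEq C] (ρ : V → C) : Term V Empty → Term V C
  | var x => const (ρ x)
  | const e => e.elim
  | lam x M => lam x (replaceConst (ρ x) x (tr ρ M))
  | app M N => app (tr ρ M) (tr ρ N)

/-! Facts on finite terms needed for the definitions below. -/

lemma vars_finite (M : Term V K) : (vars M).Finite := by
  induction M with
  | var x => exact Set.finite_singleton x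
  | const c => exact Set.finite_empty
  | lam x M ih => exact ih.insert x
  | app M N ihM ihN => exact ihM.union ihN

lemma fv_subset_vars (M : Term V K) : fv M ⊆ vars M := by
  induction M with
  | var x => exact subset_rfl
  | const c => exact subset_rfl
  | lam x M ih => exact fun y hy => Or.inr (ih hy.1)
  | app M N ihM ihN => exact Set.union_subset_union ihM ihN

lemma fv_finite (M : Term V K) : (fv M).Finite := (vars_finite M).subset (fv_subset_vars M)

lemma fv_perm (π : Equiv.Perm V) (M : Term V K) : fv (perm π M) = π '' fv M := by
  induction M with
  | var x => simp [perm, fv]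
  | const c => simp [perm, fv]
  | lam x M ih => simp [perm, fv, ih, Set.image_sdiff π.injective]
  | app M N ihM ihN => simp [perm, fv, ihM, ihN, Set.image_union]

lemma fv_lam_eq [DecidableEq V] {x z : V} {M : Term V K} (hM : z ∉ vars M) :
    fv (lam x M) = fv (perm (Equiv.swap x z) M) \ {z} := by
  have hz : z ∉ fv M := fun h => hM (fv_subset_vars M h)
  ext y
  simp only [fv, fv_perm, Set.mem_sdiff, Set.mem_singleton_iff, Set.mem_image]
  constructor
  · rintro ⟨h, hy⟩
    have hyz : y ≠ z := fun e => hz (e ▸ h)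
    exact ⟨⟨y, h, Equiv.swap_apply_of_ne_of_ne hy hyz⟩, hyz⟩
  · rintro ⟨⟨a, ha, rfl⟩, hy⟩
    have haz : a ≠ z := fun e => hz (e ▸ ha)
    have hax : a ≠ x := fun e => hy (by rw [e, Equiv.swap_apply_left])
    rw [Equiv.swap_apply_of_ne_of_ne hax haz]
    exact ⟨ha, hax⟩

lemma AlphaEq.fv_eq [DecidableEq V] {M N : Term V K} (h : AlphaEq M N) : fv M = fv N := by
  induction h with
  | refl M => rfl
  | symm _ ih => exact ih.symm
  | trans _ _ ih₁ ih₂ => exact ih₁.trans ih₂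
  | app _ _ ih₁ ih₂ => simp [fv, ih₁, ih₂]
  | abs _ _ hM hN _ ih => rw [fv_lam_eq hM, fv_lam_eq hN, ih]

lemma trunc_perm (π : Equiv.Perm V) (n : ℕ) (M : Term V K) :
    trunc n (perm π M) = perm π (trunc n M) := by
  induction n generalizing M with
  | zero => rfl
  | succ n ih => cases M <;> simp [trunc, perm, ih]

lemma vars_trunc (n : ℕ) (M : Term V K) : vars (trunc n M) ⊆ vars M := by
  induction n generalizing M with
  | zero => exact Set.empty_subset _
  | succ n ih =>
    cases M with
    | var x => exact subset_rfl
    | const c => exact subset_rfl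
    | lam x M => exact Set.insert_subset_insert (ih M)
    | app M N => exact Set.union_subset_union (ih M) (ih N)

lemma fv_trunc (n : ℕ) (M : Term V K) : fv (trunc n M) ⊆ fv M := by
  induction n generalizing M with
  | zero => exact Set.empty_subset _
  | succ n ih =>
    cases M with
    | var x => exact subset_rfl
    | const c => exact subset_rfl
    | lam x M => exact Set.sdiff_subset_sdiff_left (ih M)
    | app M N => exact Set.union_subset_union (ih M) (ih N)

lemma AlphaEq.trunc [DecidableEq V] {M N : Term V K} (h : AlphaEq M N) (n : ℕ) :
    AlphaEq (trunc n M) (trunc n N) := by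
  induction h generalizing n with
  | refl M => exact .refl _
  | symm _ ih => exact (ih n).symm
  | trans _ _ ih₁ ih₂ => exact (ih₁ n).trans (ih₂ n)
  | app _ _ ih₁ ih₂ =>
    cases n with
    | zero => exact .refl _
    | succ n => exact .app (ih₁ n) (ih₂ n)
  | abs hx hy hM hN _ ih =>
    cases n with
    | zero => exact .refl _
    | succ n =>
      refine .abs hx hy (fun h => hM (vars_trunc _ _ h)) (fun h => hN (vars_trunc _ _ h)) ?_
      rw [← trunc_perm, ← trunc_perm]
      exact ih n

/-- Renaming of constants. -/
def mapConst {L : Type w} (f : K → L) : Term V K → Term V L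
  | var x => var x
  | const c => const (f c)
  | lam x M => lam x (mapConst f M)
  | app M N => app (mapConst f M) (mapConst f N)

lemma perm_mapConst {L : Type w} (f : K → L) (π : Equiv.Perm V) (M : Term V K) :
    mapConst f (perm π M) = perm π (mapConst f M) := by
  induction M <;> simp_all [mapConst, perm]

lemma vars_mapConst {L : Type w} (f : K → L) (M : Term V K) : vars (mapConst f M) = vars M := by
  induction M <;> simp_all [mapConst, vars]

lemma AlphaEq.mapConst [DecidableEq V] {L : Type w} (f : K → L) {M N : Term V K}
    (h : AlphaEq M N) : AlphaEq (mapConst f M) (mapConst f N) := by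
  induction h with
  | refl M => exact .refl _
  | symm _ ih => exact ih.symm
  | trans _ _ ih₁ ih₂ => exact ih₁.trans ih₂
  | app _ _ ih₁ ih₂ => exact .app ih₁ ih₂
  | abs hx hy hM hN _ ih =>
    refine .abs hx hy (by rwa [vars_mapConst]) (by rwa [vars_mapConst]) ?_
    rw [← perm_mapConst, ← perm_mapConst]
    exact ih

/-- Truncating further removes information; `Option.join` merges the two copies of `*`. -/
lemma trunc_trunc {m n : ℕ} (h : m ≤ n) (M : Term V K) :
    mapConst Option.join (trunc m (trunc n M)) = trunc m M := by
  induction m generalizing n M with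
  | zero => rfl
  | succ m ih =>
    obtain ⟨n, rfl⟩ : ∃ k, n = k + 1 := ⟨n - 1, by omega⟩
    cases M <;> simp [trunc, mapConst, ih (Nat.le_of_succ_le_succ h)]

lemma AlphaEq.trunc_of_le [DecidableEq V] {m n : ℕ} (h : m ≤ n) {M N : Term V K}
    (hMN : AlphaEq (Term.trunc n M) (Term.trunc n N)) :
    AlphaEq (Term.trunc m M) (Term.trunc m N) := by
  rw [← trunc_trunc h M, ← trunc_trunc h N]
  exact (hMN.trunc m).mapConst _

/-- Terms without `*`, as terms over the original constants. -/
def strip : Term V (Option K) → Option (Term V K)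
  | var x => some (var x)
  | const c => c.map const
  | lam x M => (strip M).map (lam x)
  | app M N => (strip M).bind fun M' => (strip N).map (app M')

lemma strip_perm (π : Equiv.Perm V) (M : Term V (Option K)) :
    strip (perm π M) = (strip M).map (perm π) := by
  induction M with
  | var x => rfl
  | const c => cases c <;> rfl
  | lam x M ih => cases h : strip M <;> simp [strip, perm, ih, h]
  | app M N ihM ihN =>
    cases h : strip M <;> cases h' : strip N <;> simp [strip, perm, ihM, ihN, h, h']

lemma vars_strip {M : Term V (Option K)} {M' : Term V K} (h : strip M = some M') :
    vars M' = vars M := by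
  induction M generalizing M' with
  | var x => cases h; rfl
  | const c => cases c <;> cases h; rfl
  | lam x M ih =>
    cases e : strip M with
    | none => simp [strip, e] at h
    | some P => simp only [strip, e, Option.map_some, Option.some.injEq] at h
                subst h; simp [vars, ih e]
  | app M N ihM ihN =>
    cases e : strip M with
    | none => simp [strip, e] at h
    | some P =>
      cases e' : strip N with
      | none => simp [strip, e, e'] at h
      | some Q => simp only [strip, e, e', Option.map_some, Option.bind_some,
                    Option.some.injEq] at h
                  subst h; simp [vars, ihM e, ihN e']

lemma AlphaEq.strip [DecidableEq V] {M N : Term V (Option K)} (h : AlphaEq M N) :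
    (Term.strip M = none ∧ Term.strip N = none) ∨
      ∃ M' N', Term.strip M = some M' ∧ Term.strip N = some N' ∧ AlphaEq M' N' := by
  induction h with
  | refl M => cases e : Term.strip M with
    | none => exact .inl ⟨rfl, rfl⟩
    | some P => exact .inr ⟨P, P, rfl, rfl, .refl P⟩
  | symm _ ih =>
    rcases ih with h | ⟨M', N', h₁, h₂, h₃⟩
    · exact .inl h.symm
    · exact .inr ⟨N', M', h₂, h₁, h₃.symm⟩
  | trans _ _ ih₁ ih₂ =>
    rcases ih₁ with ⟨h₁, h₂⟩ | ⟨M', N', h₁, h₂, h₃⟩ <;>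
    rcases ih₂ with ⟨k₁, k₂⟩ | ⟨N'', P', k₁, k₂, k₃⟩
    · exact .inl ⟨h₁, k₂⟩
    · simp [h₂] at k₁
    · simp [h₂] at k₁
    · rw [h₂] at k₁
      cases k₁
      exact .inr ⟨M', P', h₁, k₂, h₃.trans k₃⟩
  | app _ _ ih₁ ih₂ =>
    rcases ih₁ with ⟨h₁, h₂⟩ | ⟨M', N', h₁, h₂, h₃⟩
    · exact .inl (by simp [Term.strip, h₁, h₂])
    · rcases ih₂ with ⟨k₁, k₂⟩ | ⟨N'', P', k₁, k₂, k₃⟩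
      · exact .inl (by simp [Term.strip, h₁, h₂, k₁, k₂])
      · exact .inr ⟨Term.app M' N'', Term.app N' P', by simp [Term.strip, h₁, k₁],
          by simp [Term.strip, h₂, k₂], .app h₃ k₃⟩
  | @abs x y z M N hx hy hM hN _ ih =>
    rw [strip_perm, strip_perm] at ih
    rcases ih with ⟨h₁, h₂⟩ | ⟨M', N', h₁, h₂, h₃⟩
    · rw [Option.map_eq_none_iff] at h₁ h₂
      exact .inl (by simp [Term.strip, h₁, h₂])
    · obtain ⟨M'', e₁, rfl⟩ := Option.map_eq_some_iff.1 h₁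
      obtain ⟨N'', e₂, rfl⟩ := Option.map_eq_some_iff.1 h₂
      exact .inr ⟨Term.lam x M'', Term.lam y N'', by simp [Term.strip, e₁],
        by simp [Term.strip, e₂],
        .abs hx hy (by rwa [vars_strip e₁]) (by rwa [vars_strip e₂]) h₃⟩

lemma exists_strip_trunc (M : Term V K) : ∃ k, ∀ n, k ≤ n → strip (trunc n M) = some M := by
  induction M with
  | var x => exact ⟨1, fun n hn => by obtain ⟨n, rfl⟩ := Nat.exists_eq_add_of_le' hn; rfl⟩
  | const c => exact ⟨1, fun n hn => by obtain ⟨n, rfl⟩ := Nat.exists_eq_add_of_le' hn; rfl⟩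
  | lam x M ih =>
    obtain ⟨k, hk⟩ := ih
    refine ⟨k + 1, fun n hn => ?_⟩
    obtain ⟨n, rfl⟩ := Nat.exists_eq_add_of_le' hn
    simp [trunc, strip, hk (n + k) (by omega)]
  | app M N ihM ihN =>
    obtain ⟨k, hk⟩ := ihM
    obtain ⟨l, hl⟩ := ihN
    refine ⟨max k l + 1, fun n hn => ?_⟩
    obtain ⟨n, rfl⟩ := Nat.exists_eq_add_of_le' hn
    simp [trunc, strip, hk (n + max k l) (by omega),
      hl (n + max k l) (by omega)]

lemma alphaEq_of_forall_trunc [DecidableEq V] {M N : Term V K}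
    (h : ∀ n, AlphaEq (trunc n M) (trunc n N)) : AlphaEq M N := by
  obtain ⟨k, hk⟩ := exists_strip_trunc M
  obtain ⟨l, hl⟩ := exists_strip_trunc N
  rcases (h (max k l)).strip with ⟨h₁, _⟩ | ⟨M', N', h₁, h₂, h₃⟩
  · rw [hk _ (le_max_left _ _)] at h₁
    cases h₁
  · rw [hk _ (le_max_left _ _)] at h₁
    rw [hl _ (le_max_right _ _)] at h₂
    cases h₁
    cases h₂
    exact h₃

end Term

/-! ### The distance given by truncations up to α-equivalence -/

/-- `inf {2⁻ⁿ | s n =α t n}`, for the sequences `s`, `t` of truncations of two terms. -/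
def truncDist {V : Type u} {K : Type v} [DecidableEq V] (s t : ℕ → Term V K) : ℝ :=
  sInf {r : ℝ | ∃ n : ℕ, Term.AlphaEq (s n) (t n) ∧ r = (1 / 2) ^ n}

section truncDist

variable {V : Type u} {K : Type v} [DecidableEq V]

lemma truncDist_bddBelow (s t : ℕ → Term V K) :
    BddBelow {r : ℝ | ∃ n : ℕ, Term.AlphaEq (s n) (t n) ∧ r = (1 / 2) ^ n} :=
  ⟨0, by rintro r ⟨n, -, rfl⟩; positivity⟩

lemma truncDist_le {s t : ℕ → Term V K} {n : ℕ} (h : Term.AlphaEq (s n) (t n)) :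
    truncDist s t ≤ (1 / 2) ^ n :=
  csInf_le (truncDist_bddBelow s t) ⟨n, h, rfl⟩

lemma truncDist_nonneg (s t : ℕ → Term V K) : 0 ≤ truncDist s t :=
  Real.sInf_nonneg (by rintro r ⟨n, -, rfl⟩; positivity)

lemma truncDist_eq_zero {s t : ℕ → Term V K} (h : ∀ n, Term.AlphaEq (s n) (t n)) :
    truncDist s t = 0 := by
  refine le_antisymm (le_of_forall_pos_le_add fun ε hε => ?_) (truncDist_nonneg s t)
  obtain ⟨n, hn⟩ := exists_pow_lt_of_lt_one hε (by norm_num : (1 / 2 : ℝ) < 1)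
  linarith [truncDist_le (h n)]

lemma truncDist_congr {s t s' t' : ℕ → Term V K} (hs : ∀ n, Term.AlphaEq (s n) (s' n))
    (ht : ∀ n, Term.AlphaEq (t n) (t' n)) : truncDist s t = truncDist s' t' := by
  have : ∀ n, Term.AlphaEq (s n) (t n) ↔ Term.AlphaEq (s' n) (t' n) := fun n =>
    ⟨fun h => ((hs n).symm.trans h).trans (ht n), fun h => ((hs n).trans h).trans (ht n).symm⟩
  simp only [truncDist, this]

lemma truncDist_comm (s t : ℕ → Term V K) : truncDist s t = truncDist t s := by
  have : ∀ n, Term.AlphaEq (s n) (t n) ↔ Term.AlphaEq (t n) (s n) := fun n =>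
    ⟨fun h => h.symm, fun h => h.symm⟩
  simp only [truncDist, this]

lemma alphaEq_of_truncDist_lt {s t : ℕ → Term V K} (h0 : Term.AlphaEq (s 0) (t 0))
    (hmono : ∀ m n, m ≤ n → Term.AlphaEq (s n) (t n) → Term.AlphaEq (s m) (t m))
    {n : ℕ} (h : truncDist s t < (1 / 2) ^ n) : Term.AlphaEq (s n) (t n) := by
  obtain ⟨r, ⟨m, hm, rfl⟩, hr⟩ := exists_lt_of_csInf_lt (s := {r : ℝ | ∃ n : ℕ,
    Term.AlphaEq (s n) (t n) ∧ r = (1 / 2) ^ n}) ⟨_, 0, h0, rfl⟩ h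
  have : n < m := by
    by_contra hmn
    exact absurd hr (not_lt.2 (pow_le_pow_of_le_one (by norm_num) (by norm_num) (not_lt.1 hmn)))
  exact hmono n m this.le hm

lemma truncDist_triangle {s t r : ℕ → Term V K} (h0 : Term.AlphaEq (s 0) (t 0))
    (h0' : Term.AlphaEq (t 0) (r 0))
    (h₁ : ∀ m n, m ≤ n → Term.AlphaEq (s n) (t n) → Term.AlphaEq (s m) (t m))
    (h₂ : ∀ m n, m ≤ n → Term.AlphaEq (t n) (r n) → Term.AlphaEq (t m) (r m)) :
    truncDist s r ≤ truncDist s t + truncDist t r := by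
  refine le_of_forall_pos_le_add fun ε hε => ?_
  obtain ⟨a, ⟨m, hm, rfl⟩, ha⟩ := exists_lt_of_csInf_lt (s := {r : ℝ | ∃ n : ℕ,
    Term.AlphaEq (s n) (t n) ∧ r = (1 / 2) ^ n}) ⟨_, 0, h0, rfl⟩
    (show truncDist s t < truncDist s t + ε / 2 by linarith)
  obtain ⟨b, ⟨n, hn, rfl⟩, hb⟩ := exists_lt_of_csInf_lt (s := {q : ℝ | ∃ n : ℕ,
    Term.AlphaEq (t n) (r n) ∧ q = (1 / 2) ^ n}) ⟨_, 0, h0', rfl⟩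
    (show truncDist t r < truncDist t r + ε / 2 by linarith)
  have hm0 : (0 : ℝ) < (1 / 2) ^ m := by positivity
  have hn0 : (0 : ℝ) < (1 / 2) ^ n := by positivity
  rcases le_total m n with h | h
  · linarith [truncDist_le (hm.trans (h₂ m n h hn))]
  · linarith [truncDist_le ((h₁ n m h hm).trans hn)]

end truncDist

/-! ### α-equivalence classes of finite terms -/

variable {V : Type u} {K : Type v}

/-- α-equivalence on finite terms as a setoid. -/
def alphaSetoid (V : Type u) (K : Type v) [DecidableEq V] : Setoid (Term V K) where
  r := Term.AlphaEq
  iseqv := ⟨.refl, .symm, .trans⟩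

/-- The set of α-equivalence classes of finite terms. -/
def FinClass (V : Type u) (K : Type v) [DecidableEq V] : Type (max u v) :=
  Quotient (alphaSetoid V K)

/-- The α-equivalence class of a finite term. -/
def FinClass.mk [DecidableEq V] (M : Term V K) : FinClass V K :=
  Quotient.mk (alphaSetoid V K) M

/-- The metric `d_α([M], [N]) = inf {2⁻ⁿ | M ^ n =α N ^ n}`. -/
instance [DecidableEq V] : MetricSpace (FinClass V K) where
  dist p q := Quotient.liftOn₂ p q (fun M N => truncDist (fun n => M.trunc n) (fun n => N.trunc n))
    (fun _ _ _ _ h₁ h₂ => truncDist_congr (fun n => Term.AlphaEq.trunc h₁ n)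
      (fun n => Term.AlphaEq.trunc h₂ n))
  dist_self p := Quotient.inductionOn p fun M => truncDist_eq_zero fun n => .refl _
  dist_comm p q := Quotient.inductionOn₂ p q fun M N => truncDist_comm _ _
  dist_triangle p q r := Quotient.inductionOn₃ p q r fun M N P =>
    truncDist_triangle (.refl _) (.refl _) (fun _ _ h => Term.AlphaEq.trunc_of_le h)
      (fun _ _ h => Term.AlphaEq.trunc_of_le h)
  eq_of_dist_eq_zero {p q} := Quotient.inductionOn₂ p q fun M N h =>
    Quotient.sound (s := alphaSetoid V K) <| Term.alphaEq_of_forall_trunc fun n =>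
      alphaEq_of_truncDist_lt (s := fun n => M.trunc n) (t := fun n => N.trunc n) (.refl _)
        (fun _ _ h => Term.AlphaEq.trunc_of_le h) (lt_of_le_of_lt (le_of_eq h) (by positivity))

/-! ### Infinitary terms -/

/-- The node labels of (finite or infinite) λ-terms. -/
inductive Node (V : Type u) (K : Type v) : Type (max u v)
  | var (x : V) : Node V K
  | const (c : K) : Node V K
  | lam (x : V) : Node V K
  | app : Node V K

/-- The index type of the immediate subterms. -/
abbrev Node.Arity : Node V K → Type
  | var _ => Empty
  | const _ => Empty
  | lam _ => Unit
  | app => Bool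

/-- The polynomial functor `X ↦ V + K + V × X + X × X` on sets. -/
abbrev termFunctor (V : Type u) (K : Type v) : PFunctor.{max u v, 0} := ⟨Node V K, Node.Arity⟩

/-- Finite and infinite raw λ-terms with variables in `V` and constants in `K`: the grammar
`M ::= x | c | λ x. M | M M` read coinductively, i.e. the final coalgebra of
`X ↦ V + K + V × X + X × X`. -/
def InfTerm (V : Type u) (K : Type v) : Type (max u v) := (termFunctor V K).M

namespace InfTerm

/-- The coalgebra structure: the root label and the immediate subterms. -/
def dest (M : InfTerm V K) : (s : Node V K) × (s.Arity → InfTerm V K) := PFunctor.M.dest M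

/-- The inverse of `dest`. -/
def mk (M : (s : Node V K) × (s.Arity → InfTerm V K)) : InfTerm V K := PFunctor.M.mk M

@[simp] lemma dest_mk (M : (s : Node V K) × (s.Arity → InfTerm V K)) : dest (mk M) = M :=
  PFunctor.M.dest_mk (F := termFunctor V K) M

/-- The inclusion of the finite terms. -/
def ofTerm : Term V K → InfTerm V K
  | .var x => mk ⟨.var x, Empty.elim⟩
  | .const c => mk ⟨.const c, Empty.elim⟩
  | .lam x M => mk ⟨.lam x, fun _ => ofTerm M⟩
  | .app M N => mk ⟨.app, fun b : Bool => if b then ofTerm N else ofTerm M⟩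

/-- The truncation `M ^ n` at depth `n`, with `*` as the new constant `none`. The function
and the argument of an application are its subterms with index `false` and `true`. -/
def trunc : ℕ → InfTerm V K → Term V (Option K)
  | 0, _ => .const none
  | n + 1, M =>
    match dest M with
    | ⟨.var x, _⟩ => .var x
    | ⟨.const c, _⟩ => .const (some c)
    | ⟨.lam x, f⟩ => .lam x (trunc n (f ()))
    | ⟨.app, f⟩ => .app (trunc n (f false)) (trunc n (f true))

/-- Free variables: `fv M = ⋃ₙ fv (M ^ n)`. -/
def fv (M : InfTerm V K) : Set V := ⋃ n, Term.fv (trunc n M)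

/-- α-equivalence: all truncations are α-equivalent. -/
def AlphaEq [DecidableEq V] (M N : InfTerm V K) : Prop :=
  ∀ n, Term.AlphaEq (trunc n M) (trunc n N)

lemma trunc_ofTerm (n : ℕ) (M : Term V K) : trunc n (ofTerm M) = Term.trunc n M := by
  induction n generalizing M with
  | zero => rfl
  | succ n ih =>
    cases M with
    | var x => rw [trunc, ofTerm, dest_mk]; rfl
    | const c => rw [trunc, ofTerm, dest_mk]; rfl
    | lam x M => rw [trunc, ofTerm, dest_mk]; exact congrArg (Term.lam x) (ih M)
    | app M N => rw [trunc, ofTerm, dest_mk]; exact congrArg₂ Term.app (ih M) (ih N)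

lemma trunc_trunc {m n : ℕ} (h : m ≤ n) (M : InfTerm V K) :
    Term.mapConst Option.join (Term.trunc m (trunc n M)) = trunc m M := by
  induction m generalizing n M with
  | zero => rfl
  | succ m ih =>
    obtain ⟨n, rfl⟩ : ∃ k, n = k + 1 := ⟨n - 1, by omega⟩
    have ih' := @ih n
    rcases hM : dest M with ⟨_ | _ | _ | _, f⟩ <;>
      simp [trunc, hM, Term.trunc, Term.mapConst, ih' (Nat.le_of_succ_le_succ h)]

lemma alphaEq_trunc_of_le [DecidableEq V] {m n : ℕ} (h : m ≤ n) {M N : InfTerm V K}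
    (hMN : Term.AlphaEq (trunc n M) (trunc n N)) : Term.AlphaEq (trunc m M) (trunc m N) := by
  rw [← trunc_trunc h M, ← trunc_trunc h N]
  exact (hMN.trunc m).mapConst _

lemma AlphaEq.fv_eq [DecidableEq V] {M N : InfTerm V K} (h : AlphaEq M N) : fv M = fv N :=
  Set.iUnion_congr fun n => (h n).fv_eq

lemma fv_ofTerm_finite (M : Term V K) : (fv (ofTerm M)).Finite :=
  (Term.fv_finite M).subset <| Set.iUnion_subset fun n => by
    rw [trunc_ofTerm]; exact Term.fv_trunc n M

end InfTerm

/-- Infinitary terms with finitely many free variables (and possibly infinitely many bound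
variables and constants). -/
def FfvTerm (V : Type u) (K : Type v) : Type (max u v) := {M : InfTerm V K // M.fv.Finite}

/-- A finite term as an infinitary term with finitely many free variables. -/
def FfvTerm.ofTerm (M : Term V K) : FfvTerm V K := ⟨InfTerm.ofTerm M, InfTerm.fv_ofTerm_finite M⟩

/-- α-equivalence on infinitary terms with finitely many free variables, as a setoid. -/
def ffvSetoid (V : Type u) (K : Type v) [DecidableEq V] : Setoid (FfvTerm V K) where
  r M N := InfTerm.AlphaEq M.1 N.1
  iseqv := ⟨fun _ _ => .refl _, fun h n => (h n).symm, fun h h' n => (h n).trans (h' n)⟩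

/-- α-equivalence classes of infinitary terms with finitely many free variables. -/
def FfvClass (V : Type u) (K : Type v) [DecidableEq V] : Type (max u v) :=
  Quotient (ffvSetoid V K)

namespace FfvClass

variable [DecidableEq V]

/-- The α-equivalence class of an infinitary term with finitely many free variables. -/
def mk (M : FfvTerm V K) : FfvClass V K := Quotient.mk (ffvSetoid V K) M

/-- The free variables of an α-equivalence class. -/
def fv (p : FfvClass V K) : Set V :=
  Quotient.liftOn p (fun M => M.1.fv) fun _ _ h => InfTerm.AlphaEq.fv_eq h

/-- The metric `d_α([M], [N]) = inf {2⁻ⁿ | M ^ n =α N ^ n}`. -/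
instance : MetricSpace (FfvClass V K) where
  dist p q := Quotient.liftOn₂ p q
    (fun M N => truncDist (fun n => M.1.trunc n) (fun n => N.1.trunc n))
    (fun _ _ _ _ h₁ h₂ => truncDist_congr h₁ h₂)
  dist_self p := Quotient.inductionOn p fun M => truncDist_eq_zero fun n => .refl _
  dist_comm p q := Quotient.inductionOn₂ p q fun M N => truncDist_comm _ _
  dist_triangle p q r := Quotient.inductionOn₃ p q r fun M N P =>
    truncDist_triangle (.refl _) (.refl _) (fun _ _ h => InfTerm.alphaEq_trunc_of_le h)
      (fun _ _ h => InfTerm.alphaEq_trunc_of_le h)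
  eq_of_dist_eq_zero {p q} := Quotient.inductionOn₂ p q fun M N h =>
    Quotient.sound (s := ffvSetoid V K) fun n =>
      alphaEq_of_truncDist_lt (s := fun n => M.1.trunc n) (t := fun n => N.1.trunc n) (.refl _)
        (fun _ _ h => InfTerm.alphaEq_trunc_of_le h) (lt_of_le_of_lt (le_of_eq h) (by positivity))

end FfvClass

/-- The closed α-equivalence classes of infinitary terms with finitely many free variables,
with the induced metric. -/
abbrev ClosedClass (V : Type u) (K : Type v) [DecidableEq V] : Type (max u v) :=
  {p : FfvClass V K // p.fv = ∅}

end InfLam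

end

namespace InfLam

universe u v w u' v' u'' v''

namespace Term

/-- A leaf of a term: a variable or a constant. -/
def leaf {V : Type u} {K : Type v} : V ⊕ K → Term V K := Sum.elim var const

/-- The set of constants of a term. -/
def consts {V : Type u} {K : Type v} : Term V K → Set K
  | var _ => ∅
  | const c => {c}
  | lam _ M => consts M
  | app M N => consts M ∪ consts N

lemma consts_finite {V : Type u} {K : Type v} (M : Term V K) : (consts M).Finite := by
  induction M with
  | var x => exact Set.finite_empty
  | const c => exact Set.finite_singleton c
  | lam x M ih => exact ih
  | app M N ihM ihN => exact ihM.union ihN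

/-- The number of inner nodes of a term. -/
def size {V : Type u} {K : Type v} : Term V K → ℕ
  | var _ => 0
  | const _ => 0
  | lam _ M => size M + 1
  | app M N => size M + size N + 1

lemma size_perm {V : Type u} {K : Type v} (π : Equiv.Perm V) (M : Term V K) :
    size (perm π M) = size M := by
  induction M <;> simp_all [size, perm]

lemma leaf_injective {V : Type u} {K : Type v} :
    Function.Injective (leaf : V ⊕ K → Term V K) := by
  rintro (a | a) (b | b) h <;> simp_all [leaf]

lemma leaf_ne_lam {V : Type u} {K : Type v} (a : V ⊕ K) (x : V) (M : Term V K) :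
    leaf a ≠ lam x M := by
  cases a <;> simp [leaf]

lemma leaf_ne_app {V : Type u} {K : Type v} (a : V ⊕ K) (M N : Term V K) : leaf a ≠ app M N := by
  cases a <;> simp [leaf]

/-- Rename the binders of a term by their de Bruijn level: a binder below `d + i` others gets the
name `ξ (d + i)`. Free variables are replaced according to `σ` and constants according to `κ`. -/
def relabel {V : Type u} {K : Type v} {W : Type u'} {L : Type v'} [DecidableEq V] (ξ : ℕ → W) :
    ℕ → (V → W ⊕ L) → (K → W ⊕ L) → Term V K → Term W L
  | _, σ, _, var x => leaf (σ x)
  | _, _, κ, const c => leaf (κ c)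
  | d, σ, κ, lam x M =>
      lam (ξ d) (relabel ξ (d + 1) (Function.update σ x (Sum.inl (ξ d))) κ M)
  | d, σ, κ, app M N => app (relabel ξ d σ κ M) (relabel ξ d σ κ N)

section relabel

variable {V : Type u} {K : Type v} {W : Type u'} {L : Type v'} [DecidableEq V]

lemma relabel_congr {ξ : ℕ → W} {d : ℕ} {σ σ' : V → W ⊕ L} {κ κ' : K → W ⊕ L} {M : Term V K}
    (hσ : ∀ x ∈ fv M, σ x = σ' x) (hκ : ∀ c ∈ consts M, κ c = κ' c) :
    relabel ξ d σ κ M = relabel ξ d σ' κ' M := by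
  induction M generalizing d σ σ' with
  | var x => simp [relabel, hσ x rfl]
  | const c => simp [relabel, hκ c rfl]
  | lam x M ih =>
    rw [relabel, relabel, ih ?_ hκ]
    intro y hy
    by_cases h : y = x
    · simp [h]
    · simp [h, hσ y ⟨hy, h⟩]
  | app M N ihM ihN =>
    rw [relabel, relabel, ihM (fun x hx => hσ x (.inl hx)) (fun c hc => hκ c (.inl hc)),
      ihN (fun x hx => hσ x (.inr hx)) (fun c hc => hκ c (.inr hc))]

lemma relabel_perm (ξ : ℕ → W) (d : ℕ) (σ : V → W ⊕ L) (κ : K → W ⊕ L) (π : Equiv.Perm V)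
    (M : Term V K) : relabel ξ d σ κ (perm π M) = relabel ξ d (σ ∘ π) κ M := by
  induction M generalizing d σ with
  | var x => rfl
  | const c => rfl
  | lam x M ih =>
    rw [perm, relabel, relabel, ih, Function.update_comp_equiv, Equiv.symm_apply_apply]
  | app M N ihM ihN => rw [perm, relabel, relabel, ihM, ihN]

lemma relabel_perm_swap (ξ : ℕ → W) (d : ℕ) (σ : V → W ⊕ L) (κ : K → W ⊕ L) {x z : V}
    {M : Term V K} (hz : z ∉ vars M) (a : W ⊕ L) :
    relabel ξ d (Function.update σ z a) κ (perm (Equiv.swap x z) M) =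
      relabel ξ d (Function.update σ x a) κ M := by
  rw [relabel_perm]
  refine relabel_congr (fun y hy => ?_) fun _ _ => rfl
  have hyz : y ≠ z := fun e => hz (e ▸ fv_subset_vars M hy)
  by_cases h : y = x
  · simp [h]
  · simp [Equiv.swap_apply_of_ne_of_ne h hyz, h, hyz]

lemma AlphaEq.relabel_eq {M N : Term V K} (h : AlphaEq M N) (ξ : ℕ → W) (d : ℕ)
    (σ : V → W ⊕ L) (κ : K → W ⊕ L) : relabel ξ d σ κ M = relabel ξ d σ κ N := by
  induction h generalizing d σ with
  | refl M => rfl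
  | symm _ ih => exact (ih d σ).symm
  | trans _ _ ih₁ ih₂ => exact (ih₁ d σ).trans (ih₂ d σ)
  | app _ _ ih₁ ih₂ => rw [relabel, relabel, ih₁, ih₂]
  | abs _ _ hM hN _ ih =>
    rw [relabel, relabel, ← relabel_perm_swap ξ _ σ κ hM, ← relabel_perm_swap ξ _ σ κ hN, ih]

lemma alphaEq_of_relabel_eq [Infinite V] {ξ : ℕ → W} (hξ : Function.Injective ξ) {d : ℕ}
    {σ : V → W ⊕ L} {κ : K → W ⊕ L} (hσ : Function.Injective σ) (hκ : Function.Injective κ)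
    (hσκ : ∀ x c, σ x ≠ κ c) (hσξ : ∀ x i, d ≤ i → σ x ≠ Sum.inl (ξ i))
    (hκξ : ∀ c i, d ≤ i → κ c ≠ Sum.inl (ξ i)) {M N : Term V K}
    (h : relabel ξ d σ κ M = relabel ξ d σ κ N) : AlphaEq M N := by
  induction hn : size M using Nat.strong_induction_on generalizing d σ M N with
  | _ n ih =>
  cases M with
  | var x => cases N with
    | var y => rw [hσ (leaf_injective h)]; exact .refl _
    | const c => exact absurd (leaf_injective h) (hσκ _ _)
    | lam => exact absurd h (leaf_ne_lam _ _ _)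
    | app => exact absurd h (leaf_ne_app _ _ _)
  | const c => cases N with
    | var y => exact absurd (leaf_injective h).symm (hσκ _ _)
    | const c => rw [hκ (leaf_injective h)]; exact .refl _
    | lam => exact absurd h (leaf_ne_lam _ _ _)
    | app => exact absurd h (leaf_ne_app _ _ _)
  | lam x M => cases N with
    | var => exact absurd h.symm (leaf_ne_lam _ _ _)
    | const => exact absurd h.symm (leaf_ne_lam _ _ _)
    | app => simp [relabel] at h
    | lam y N =>
      obtain ⟨z, hz⟩ := (((vars_finite M).union (vars_finite N)).union
        (Set.toFinite {x, y})).exists_notMem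
      simp only [Set.mem_union, Set.mem_insert_iff, Set.mem_singleton_iff, not_or] at hz
      obtain ⟨⟨hzM, hzN⟩, hzx, hzy⟩ := hz
      simp only [relabel, lam.injEq, true_and] at h
      rw [← relabel_perm_swap ξ _ σ κ hzM, ← relabel_perm_swap ξ _ σ κ hzN] at h
      refine .abs hzx hzy hzM hzN (ih (size M) (by rw [← hn, size]; omega) ?_ ?_ ?_ ?_ h
        (size_perm _ _))
      · intro a b hab
        by_cases ha : a = z <;> by_cases hb : b = z <;>
          simp only [Function.update_apply, ha, hb, if_true, if_false] at hab ⊢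
        · exact absurd hab.symm (hσξ b d le_rfl)
        · exact absurd hab (hσξ a d le_rfl)
        · exact hσ hab
      · intro a c hac
        by_cases ha : a = z <;> simp only [Function.update_apply, ha, if_true, if_false] at hac
        · exact hκξ c d le_rfl hac.symm
        · exact hσκ a c hac
      · intro a i hi hai
        by_cases ha : a = z <;> simp only [Function.update_apply, ha, if_true, if_false] at hai
        · have := hξ (Sum.inl_injective hai)
          omega
        · exact hσξ a i (by omega) hai
      · exact fun c i hi => hκξ c i (by omega)
  | app M M' => cases N with
    | var => exact absurd h.symm (leaf_ne_app _ _ _)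
    | const => exact absurd h.symm (leaf_ne_app _ _ _)
    | lam => simp [relabel] at h
    | app N N' =>
      simp only [relabel, app.injEq] at h
      exact .app (ih _ (by rw [← hn, size]; omega) hσ hσκ hσξ hκξ h.1 rfl)
        (ih _ (by rw [← hn, size]; omega) hσ hσκ hσξ hκξ h.2 rfl)

lemma relabel_leaf {ξ : ℕ → W} {d : ℕ} {σ : V → W ⊕ L} {κ : K → W ⊕ L} (a : V ⊕ K) :
    relabel ξ d σ κ (leaf a) = leaf (Sum.elim σ κ a) := by
  cases a <;> rfl

lemma relabel_relabel {U : Type u''} {J : Type v''} [DecidableEq W] (ζ : ℕ → U) {ξ : ℕ → W}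
    (hξ : Function.Injective ξ) (d : ℕ) (μ : W → U ⊕ J) (ν : L → U ⊕ J) {σ : V → W ⊕ L}
    {κ : K → W ⊕ L} {M : Term V K} (hσ : ∀ x i, d ≤ i → σ x ≠ Sum.inl (ξ i))
    (hκ : ∀ c ∈ consts M, ∀ i, d ≤ i → κ c ≠ Sum.inl (ξ i)) :
    relabel ζ d μ ν (relabel ξ d σ κ M) =
      relabel ζ d (Sum.elim μ ν ∘ σ) (Sum.elim μ ν ∘ κ) M := by
  have key : ∀ (a : W ⊕ L) (d : ℕ) (μ : W → U ⊕ J), a ≠ Sum.inl (ξ d) →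
      Sum.elim (Function.update μ (ξ d) (Sum.inl (ζ d))) ν a = Sum.elim μ ν a := by
    rintro (a | a) d μ h
    · simp [show a ≠ ξ d from fun e => h (e ▸ rfl)]
    · rfl
  induction M generalizing d μ σ with
  | var x => exact relabel_leaf _
  | const c => exact relabel_leaf _
  | lam x M ih =>
    rw [relabel, relabel, relabel, ih (d + 1) _ ?_ fun c hc i hi => hκ c hc i (by omega)]
    · congr 1
      refine relabel_congr (fun y _ => ?_) fun c hc => key _ _ _ (hκ c hc d le_rfl)
      by_cases h : y = x
      · simp [h]
      · simpa [h] using key _ _ _ (hσ y d le_rfl)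
    · intro y i hi h
      by_cases hy : y = x <;> simp only [Function.update_apply, hy, if_true, if_false] at h
      · have := hξ (Sum.inl_injective h)
        omega
      · exact hσ y i (by omega) h
  | app M N ihM ihN =>
    rw [relabel, relabel, relabel, ihM d μ hσ fun c hc => hκ c (.inl hc),
      ihN d μ hσ fun c hc => hκ c (.inr hc)]

lemma trunc_leaf (n : ℕ) (a : W ⊕ L) : trunc (n + 1) (leaf a) = leaf (a.map id some) := by
  cases a <;> rfl

lemma trunc_relabel (n : ℕ) (ξ : ℕ → W) (d : ℕ) (σ : V → W ⊕ L) (κ : K → W ⊕ L) (M : Term V K) :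
    trunc n (relabel ξ d σ κ M) = relabel ξ d (Sum.map id some ∘ σ)
      (fun c => c.elim (Sum.inr none) (Sum.map id some ∘ κ)) (trunc n M) := by
  induction n generalizing d σ M with
  | zero => rfl
  | succ n ih =>
    cases M with
    | var x => exact trunc_leaf _ _
    | const c => exact trunc_leaf _ _
    | lam x M => simp only [trunc, relabel, ih, Function.comp_update, Sum.map_inl, id]
    | app M N => simp only [trunc, relabel, ih]

lemma exists_of_mem_fv_relabel {ξ : ℕ → W} {d : ℕ} {σ : V → W ⊕ L} {κ : K → W ⊕ L}
    {M : Term V K} {z : W} (hz : z ∈ fv (relabel ξ d σ κ M)) :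
    (∃ x, σ x = Sum.inl z) ∨ ∃ c, κ c = Sum.inl z := by
  have key : ∀ a : W ⊕ L, z ∈ fv (leaf a) → a = Sum.inl z := by
    rintro (a | a) h
    · exact congrArg Sum.inl h.symm
    · exact h.elim
  induction M generalizing d σ with
  | var x => exact .inl ⟨x, key _ hz⟩
  | const c => exact .inr ⟨c, key _ hz⟩
  | lam x M ih =>
    refine (ih hz.1).imp_left ?_
    rintro ⟨y, hy⟩
    by_cases h : y = x
    · simp only [h, Function.update_self, Sum.inl.injEq] at hy
      exact absurd hy.symm hz.2
    · exact ⟨y, by simpa [h] using hy⟩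
  | app M N ihM ihN => exact hz.elim ihM ihN

end relabel

/-! ### The translation -/

section tr

variable {V : Type u} {C : Type v} [DecidableEq V]

/-- Replace the free variables of a term according to `σ`, without renaming binders. -/
def substLeaf (σ : V → V ⊕ C) : Term V Empty → Term V C
  | var x => leaf (σ x)
  | const e => e.elim
  | lam x M => lam x (substLeaf (Function.update σ x (Sum.inl x)) M)
  | app M N => app (substLeaf σ M) (substLeaf σ N)

lemma replaceConst_substLeaf [DecidableEq C] (c : C) (x : V) (σ : V → V ⊕ C) (M : Term V Empty) :
    replaceConst c x (substLeaf σ M) =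
      substLeaf (fun y => if σ y = Sum.inr c then Sum.inl x else σ y) M := by
  induction M generalizing σ with
  | var y =>
    rcases h : σ y with z | d
    · simp [substLeaf, leaf, replaceConst, h]
    · by_cases hd : d = c <;> simp [substLeaf, leaf, replaceConst, h, hd]
  | const e => exact e.elim
  | lam y M ih =>
    rw [substLeaf, replaceConst, substLeaf, ih]
    congr 2
    funext z
    by_cases h : z = y <;> simp [h]
  | app M N ihM ihN => rw [substLeaf, replaceConst, substLeaf, ihM, ihN]

lemma tr_eq_substLeaf [DecidableEq C] {ρ : V → C} (hρ : Function.Injective ρ)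
    (M : Term V Empty) : tr ρ M = substLeaf (Sum.inr ∘ ρ) M := by
  induction M with
  | var x => rfl
  | const e => exact e.elim
  | lam x M ih =>
    rw [tr, substLeaf, ih, replaceConst_substLeaf]
    congr 2
    funext z
    by_cases h : z = x
    · simp [h]
    · simp [h, hρ.eq_iff]
  | app M N ihM ihN => rw [tr, substLeaf, ihM, ihN]

lemma relabel_substLeaf {W : Type u'} {L : Type v'} (ξ : ℕ → W) (d : ℕ) (σ : V → V ⊕ C)
    (hσ : ∀ x y, σ x = Sum.inl y → x = y) (μ : V → W ⊕ L) (ν : C → W ⊕ L) (M : Term V Empty) :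
    relabel ξ d μ ν (substLeaf σ M) = relabel ξ d (Sum.elim μ ν ∘ σ) Empty.elim M := by
  induction M generalizing d σ μ with
  | var x => exact relabel_leaf _
  | const e => exact e.elim
  | lam x M ih =>
    rw [substLeaf, relabel, relabel, ih]
    · congr 2
      funext y
      by_cases h : y = x
      · simp [h]
      · rcases hy : σ y with z | z
        · simp [h, hy, ← hσ y z hy]
        · simp [h, hy]
    · intro y z hyz
      by_cases h : y = x
      · simpa [h] using hyz
      · exact hσ y z (by simpa [h] using hyz)
  | app M N ihM ihN => rw [substLeaf, relabel, relabel, ihM _ _ hσ, ihN _ _ hσ]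

/-- The α-normal form of a term: binders are named by their de Bruijn level, and free variables
become constants. -/
def normalForm {K : Type w} : Term V K → Term ℕ (V ⊕ K) :=
  relabel id 0 (Sum.inr ∘ Sum.inl) (Sum.inr ∘ Sum.inr)

lemma normalForm_eq_iff {K : Type w} [Infinite V] {M N : Term V K} :
    normalForm M = normalForm N ↔ AlphaEq M N :=
  ⟨alphaEq_of_relabel_eq Function.injective_id (Sum.inr_injective.comp Sum.inl_injective)
    (Sum.inr_injective.comp Sum.inr_injective) (by simp) (by simp) (by simp),
    fun h => h.relabel_eq _ _ _ _⟩

/-- A representative of the class of `tr ρ M` with binders named by their de Bruijn level. -/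
def canonTr (ξ : ℕ → V) (ρ : V → C) : Term V Empty → Term V C :=
  relabel ξ 0 (Sum.inr ∘ ρ) Empty.elim

lemma normalForm_canonTr {ξ : ℕ → V} (hξ : Function.Injective ξ) (ρ : V → C)
    (M : Term V Empty) :
    normalForm (canonTr ξ ρ M) = relabel id 0 (Sum.inr ∘ Sum.inr ∘ ρ) Empty.elim M := by
  rw [normalForm, canonTr, relabel_relabel _ hξ _ _ _ (by simp) fun c => c.elim]
  exact relabel_congr (fun _ _ => rfl) fun c => c.elim

lemma normalForm_tr [DecidableEq C] {ρ : V → C} (hρ : Function.Injective ρ) (M : Term V Empty) :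
    normalForm (tr ρ M) = relabel id 0 (Sum.inr ∘ Sum.inr ∘ ρ) Empty.elim M := by
  rw [normalForm, tr_eq_substLeaf hρ, relabel_substLeaf _ _ _ (by simp)]
  rfl

lemma tr_alphaEq_canonTr [DecidableEq C] [Infinite V] {ξ : ℕ → V} (hξ : Function.Injective ξ)
    {ρ : V → C} (hρ : Function.Injective ρ) (M : Term V Empty) :
    AlphaEq (tr ρ M) (canonTr ξ ρ M) := by
  rw [← normalForm_eq_iff, normalForm_tr hρ, normalForm_canonTr hξ]

lemma fv_tr [DecidableEq C] [Infinite V] {ρ : V → C} (hρ : Function.Injective ρ)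
    (M : Term V Empty) : fv (tr ρ M) = ∅ := by
  rw [(tr_alphaEq_canonTr (Infinite.natEmbedding V).injective hρ M).fv_eq]
  refine Set.eq_empty_of_forall_notMem fun z hz => ?_
  rcases exists_of_mem_fv_relabel hz with ⟨x, hx⟩ | ⟨c, -⟩
  · cases hx
  · exact c.elim

lemma AlphaEq.trunc_canonTr_eq {M N : Term V Empty} {n : ℕ}
    (h : AlphaEq (Term.trunc n M) (Term.trunc n N)) (ξ : ℕ → V) (ρ : V → C) :
    Term.trunc n (canonTr ξ ρ M) = Term.trunc n (canonTr ξ ρ N) := by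
  rw [canonTr, trunc_relabel, trunc_relabel, h.relabel_eq]

lemma alphaEq_trunc_tr_iff [DecidableEq C] [Infinite V] {ρ : V → C} (hρ : Function.Injective ρ)
    {M N : Term V Empty} {n : ℕ} :
    AlphaEq (trunc n (tr ρ M)) (trunc n (tr ρ N)) ↔ AlphaEq (trunc n M) (trunc n N) := by
  obtain ⟨ξ, hξ⟩ : ∃ ξ : ℕ → V, Function.Injective ξ := ⟨_, (Infinite.natEmbedding V).injective⟩
  have hc := fun P => (tr_alphaEq_canonTr hξ hρ P).trunc n
  refine ⟨fun h => ?_, fun h => (hc M).trans ?_⟩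
  · have h' := normalForm_eq_iff.2 (((hc M).symm.trans h).trans (hc N))
    rw [normalForm, canonTr, trunc_relabel, trunc_relabel,
      relabel_relabel _ hξ _ _ _ (by simp) (by simp [Option.forall]),
      relabel_relabel _ hξ _ _ _ (by simp) (by simp [Option.forall])] at h'
    refine alphaEq_of_relabel_eq Function.injective_id ?_ ?_ ?_ ?_ ?_ h'
    · intro x y hxy
      simpa [hρ.eq_iff] using hxy
    · intro x y
      rcases x with _ | e
      · rcases y with _ | e
        · simp
        · exact e.elim
      · exact e.elim
    · simp [Option.forall]
    · simp
    · simp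
  · rw [h.trunc_canonTr_eq ξ ρ]
    exact (hc N).symm

lemma exists_tr_alphaEq [DecidableEq C] [Infinite V] (ρ : V ≃ C) {P : Term V C}
    (hP : fv P = ∅) : ∃ N, AlphaEq (tr ρ N) P := by
  obtain ⟨v⟩ : Nonempty V := inferInstance
  have hfin : (insert v (ρ.symm '' consts P)).Finite := ((consts_finite P).image _).insert v
  have := hfin.infinite_compl.to_subtype
  let ζ := Infinite.natEmbedding ↥(insert v (ρ.symm '' consts P))ᶜ
  let ξ : ℕ → V := fun i => ζ i
  have hξ : Function.Injective ξ := Subtype.val_injective.comp ζ.injective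
  have hv : ∀ i, v ≠ ξ i := fun i h => (ζ i).2 (.inl h.symm)
  have hc : ∀ c ∈ consts P, ∀ i, ρ.symm c ≠ ξ i := fun c hc i h =>
    (ζ i).2 (.inr ⟨c, hc, h⟩)
  refine ⟨relabel ξ 0 (fun _ => Sum.inl v) (fun c => Sum.inl (ρ.symm c)) P, ?_⟩
  rw [← normalForm_eq_iff, normalForm_tr ρ.injective, relabel_relabel _ hξ]
  · exact relabel_congr (by simp [hP]) (by simp)
  · exact fun _ i _ h => hv i (Sum.inl_injective h)
  · exact fun c hc' i _ h => hc c hc' i (Sum.inl_injective h)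

end tr

/-- Replace the constant `*` by the constant `c`. -/
def fill {V : Type u} {K : Type v} (c : K) : Term V (Option K) → Term V K :=
  mapConst fun k => k.getD c

lemma fv_mapConst {V : Type u} {K : Type v} {L : Type w} (f : K → L) (M : Term V K) :
    fv (mapConst f M) = fv M := by
  induction M <;> simp_all [mapConst, fv]

end Term

namespace InfTerm

variable {V : Type u} {K : Type v}

lemma trunc_fill_trunc (c : K) (n : ℕ) (M : InfTerm V K) :
    Term.trunc n (Term.fill c (trunc n M)) = trunc n M := by
  induction n generalizing M with
  | zero => rfl
  | succ n ih =>
    simp only [Term.fill] at ih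
    rcases hM : dest M with ⟨_ | _ | _ | _, f⟩ <;>
      simp [trunc, hM, Term.fill, Term.trunc, Term.mapConst, ih]

lemma fv_trunc_subset (n : ℕ) (M : InfTerm V K) : Term.fv (trunc n M) ⊆ fv M :=
  Set.subset_iUnion (fun n => Term.fv (trunc n M)) n

end InfTerm

/-! ### Limits of coherent sequences of finite terms -/

namespace Term

variable {V : Type u} {K : Type v}

/-- The immediate subterms of a term, where `b` selects between function and argument. -/
def child (b : Bool) : Term V K → Term V K
  | var x => var x
  | const c => const c
  | lam _ M => M
  | app M N => if b then N else M

/-- One step of the corecursion that computes the limit of a sequence of finite terms. -/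
def limitStep (s : ℕ → Term V K) : termFunctor V K (ℕ → Term V K) :=
  match s 1 with
  | var x => ⟨.var x, Empty.elim⟩
  | const c => ⟨.const c, Empty.elim⟩
  | lam x _ => ⟨.lam x, fun _ n => child false (s (n + 1))⟩
  | app _ _ => ⟨.app, fun (b : Bool) n => child b (s (n + 1))⟩

/-- The limit of a sequence of finite terms whose truncations are coherent. -/
def limit (s : ℕ → Term V K) : InfTerm V K := PFunctor.M.corec limitStep s

lemma dest_limit (s : ℕ → Term V K) :
    InfTerm.dest (limit s) = ⟨(limitStep s).1, fun i => limit ((limitStep s).2 i)⟩ :=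
  PFunctor.M.dest_corec limitStep s

lemma trunc_child {b : Bool} {m : ℕ} {M N : Term V K} (h : trunc (m + 1) M = trunc (m + 1) N) :
    trunc m (child b M) = trunc m (child b N) := by
  cases M <;> cases N <;> cases b <;> simp_all [trunc, child]

lemma trunc_limit {s : ℕ → Term V K} (hs : ∀ m n, m ≤ n → trunc m (s n) = trunc m (s m))
    (n : ℕ) : InfTerm.trunc n (limit s) = trunc n (s n) := by
  induction n generalizing s with
  | zero => rfl
  | succ n ih =>
    have h1 := hs 1 (n + 1) (by omega)
    have ih' : ∀ b, InfTerm.trunc n (limit fun n => child b (s (n + 1))) =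
        trunc n (child b (s (n + 1))) :=
      fun b => ih fun m k hmk => trunc_child (hs (m + 1) (k + 1) (by omega))
    rw [InfTerm.trunc, dest_limit, limitStep]
    cases e : s 1 <;> cases e' : s (n + 1) <;> simp_all [trunc, child]

end Term

/-! ### The isometry -/

section isometry

variable {V : Type u} {C : Type v} [DecidableEq V]

lemma FinClass.dist_mk {K : Type w} (M N : Term V K) :
    dist (FinClass.mk M) (FinClass.mk N) = truncDist (fun n => M.trunc n) fun n => N.trunc n :=
  rfl

lemma FfvClass.dist_mk {K : Type w} (M N : FfvTerm V K) :
    dist (FfvClass.mk M) (FfvClass.mk N) =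
      truncDist (fun n => M.1.trunc n) fun n => N.1.trunc n :=
  rfl

lemma FinClass.alphaEq_trunc_of_dist_lt {K : Type w} {M N : Term V K} {n : ℕ}
    (h : dist (FinClass.mk M) (FinClass.mk N) < (1 / 2) ^ n) :
    Term.AlphaEq (M.trunc n) (N.trunc n) :=
  alphaEq_of_truncDist_lt (s := fun n => M.trunc n) (t := fun n => N.trunc n) (.refl _)
    (fun _ _ h => Term.AlphaEq.trunc_of_le h) h

variable [DecidableEq C] [Infinite V]

/-- The class of the translation of a finite term. -/
def closedTr (ρ : V ≃ C) (M : Term V Empty) : ClosedClass V C :=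
  ⟨FfvClass.mk (FfvTerm.ofTerm (Term.tr ρ M)), by
    refine Set.subset_empty_iff.1 (Set.iUnion_subset fun n => ?_)
    rw [← Term.fv_tr ρ.injective M]
    exact (congrArg Term.fv (InfTerm.trunc_ofTerm n _)).trans_subset (Term.fv_trunc n _)⟩

lemma dist_closedTr (ρ : V ≃ C) (M N : Term V Empty) :
    dist (closedTr ρ M) (closedTr ρ N) = dist (FinClass.mk M) (FinClass.mk N) := by
  rw [Subtype.dist_eq, closedTr, closedTr, FfvClass.dist_mk, FinClass.dist_mk]
  simp only [truncDist, FfvTerm.ofTerm, InfTerm.trunc_ofTerm,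
    Term.alphaEq_trunc_tr_iff ρ.injective]

/-- The translation on α-equivalence classes. -/
def trClass (ρ : V ≃ C) (p : FinClass V Empty) : ClosedClass V C :=
  Quotient.liftOn p (closedTr ρ) fun M N h => by
    rw [← dist_eq_zero, dist_closedTr, dist_eq_zero]
    exact Quotient.sound h

lemma isometry_trClass (ρ : V ≃ C) : Isometry (trClass ρ) :=
  Isometry.of_dist_eq fun p q => Quotient.inductionOn₂ p q fun M N => dist_closedTr ρ M N

lemma exists_dist_closedTr_le (ρ : V ≃ C) (p : ClosedClass V C) (n : ℕ) :
    ∃ N, dist (closedTr ρ N) p ≤ (1 / 2) ^ n := by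
  obtain ⟨p, hp⟩ := p
  induction p using Quotient.inductionOn with
  | h M =>
    obtain ⟨c⟩ : Nonempty C := ρ.symm.nonempty
    obtain ⟨N, hN⟩ := Term.exists_tr_alphaEq ρ (P := Term.fill c (M.1.trunc n)) <| by
      rw [Term.fill, Term.fv_mapConst]
      exact Set.subset_empty_iff.1 ((InfTerm.fv_trunc_subset n M.1).trans_eq hp)
    refine ⟨N, truncDist_le (n := n) ?_⟩
    have h := hN.trunc n
    rw [InfTerm.trunc_fill_trunc] at h
    exact (congrArg (Term.AlphaEq · _) (InfTerm.trunc_ofTerm n _)).mpr h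

lemma denseRange_trClass (ρ : V ≃ C) : DenseRange (trClass ρ) := by
  refine Metric.denseRange_iff.2 fun p r hr => ?_
  obtain ⟨n, hn⟩ := exists_pow_lt_of_lt_one hr (by norm_num : (1 / 2 : ℝ) < 1)
  obtain ⟨N, hN⟩ := exists_dist_closedTr_le ρ p n
  exact ⟨FinClass.mk N, by rw [dist_comm]; exact hN.trans_lt hn⟩

lemma exists_limit_closedTr (ρ : V ≃ C) {N : ℕ → Term V Empty}
    (hN : ∀ m n, m ≤ n → Term.AlphaEq ((N n).trunc m) ((N m).trunc m)) :
    ∃ p : ClosedClass V C, ∀ n, dist (closedTr ρ (N n)) p ≤ (1 / 2) ^ n := by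
  obtain ⟨ξ, hξ⟩ : ∃ ξ : ℕ → V, Function.Injective ξ := ⟨_, (Infinite.natEmbedding V).injective⟩
  have hlim := Term.trunc_limit (s := fun n => Term.canonTr ξ ρ (N n)) fun m n hmn =>
    (hN m n hmn).trunc_canonTr_eq ξ ρ
  have hα := fun n => Term.tr_alphaEq_canonTr hξ ρ.injective (N n)
  have hfv : (Term.limit fun n => Term.canonTr ξ ρ (N n)).fv = ∅ := by
    refine Set.subset_empty_iff.1 (Set.iUnion_subset fun n => ?_)
    rw [hlim, ← Term.fv_tr ρ.injective (N n), (hα n).fv_eq]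
    exact Term.fv_trunc n _
  refine ⟨⟨FfvClass.mk ⟨_, hfv ▸ Set.finite_empty⟩, hfv⟩, fun n => truncDist_le (n := n) ?_⟩
  exact (congrArg₂ Term.AlphaEq (InfTerm.trunc_ofTerm n _) (hlim n)).mpr ((hα n).trunc n)

lemma completeSpace_closedClass (ρ : V ≃ C) : CompleteSpace (ClosedClass V C) := by
  refine Metric.complete_of_convergent_controlled_sequences (fun n => (1 / 2) ^ (n + 2))
    (fun n => by positivity) fun u hu => ?_
  choose N hN using fun n => exists_dist_closedTr_le ρ (u n) (n + 2)
  obtain ⟨p, hp⟩ := exists_limit_closedTr ρ (N := N) fun m n hmn => by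
    refine FinClass.alphaEq_trunc_of_dist_lt ?_
    rw [← dist_closedTr ρ]
    have h1 := dist_triangle4 (closedTr ρ (N n)) (u n) (u m) (closedTr ρ (N m))
    have h2 := hu m n m hmn le_rfl
    have h3 := hN m
    rw [dist_comm] at h3
    have h4 : (1 / 2 : ℝ) ^ (n + 2) ≤ (1 / 2) ^ (m + 2) :=
      pow_le_pow_of_le_one (by norm_num) (by norm_num) (by omega)
    have h5 : (1 / 2 : ℝ) ^ (m + 2) = (1 / 2) ^ m / 4 := by ring
    have h6 : (0 : ℝ) < (1 / 2) ^ m := by positivity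
    linarith [hN n]
  refine ⟨p, tendsto_iff_dist_tendsto_zero.2 ?_⟩
  have hlim := (tendsto_pow_atTop_nhds_zero_of_lt_one (r := (1 / 2 : ℝ)) (by norm_num)
    (by norm_num)).const_mul 2
  rw [mul_zero] at hlim
  refine squeeze_zero (fun _ => dist_nonneg) (fun n => ?_) hlim
  have h1 := dist_triangle (u n) (closedTr ρ (N n)) p
  have h2 := hN n
  rw [dist_comm] at h2
  have h4 : (1 / 2 : ℝ) ^ (n + 2) ≤ (1 / 2) ^ n :=
    pow_le_pow_of_le_one (by norm_num) (by norm_num) (by omega)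
  linarith [hp n]

end isometry

end InfLam

theorem mainTheorem11 {V : Type*} {C : Type*} [DecidableEq V] [DecidableEq C]
    [Countable V] [Infinite V] (ρ : V ≃ C) :
    ∃! Φ : UniformSpace.Completion (InfLam.FinClass V Empty) ≃ᵢ InfLam.ClosedClass V C,
      ∀ M : InfLam.Term V Empty,
        (Φ (InfLam.FinClass.mk M : UniformSpace.Completion (InfLam.FinClass V Empty))).1 =
          InfLam.FfvClass.mk (InfLam.FfvTerm.ofTerm (InfLam.Term.tr ρ M)) := by
  have := InfLam.completeSpace_closedClass ρ
  have hT := InfLam.isometry_trClass ρ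
  have hE := hT.completion_extension
  have hcoe := UniformSpace.Completion.extension_coe hT.uniformContinuous
  have hsurj : Function.Surjective (UniformSpace.Completion.extension (InfLam.trClass ρ)) := by
    refine Set.range_eq_univ.1 ?_
    rw [← hE.isClosedEmbedding.isClosed_range.closure_eq]
    refine ((InfLam.denseRange_trClass ρ).mono ?_).closure_eq
    rintro _ ⟨p, rfl⟩
    exact ⟨p, hcoe p⟩
  refine ⟨⟨Equiv.ofBijective _ ⟨hE.injective, hsurj⟩, hE⟩, fun M => ?_, fun Ψ hΨ => ?_⟩
  · exact congrArg Subtype.val (hcoe (InfLam.FinClass.mk M))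
  · refine IsometryEquiv.ext fun p => congrFun (UniformSpace.Completion.ext Ψ.continuous
      hE.continuous fun q => ?_) p
    induction q using Quotient.inductionOn with
    | h M => exact Subtype.ext ((hΨ M).trans
        (congrArg Subtype.val (hcoe (InfLam.FinClass.mk M))).symm)
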